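/- Let $G$ be a finite connected simple cubic plane graph with a chosen outer face, and let $\overline G$ be its dual multigraph: its vertices are the faces of $G$, and every edge $e$ of $G$ gives a dual edge $\overline e$ joining the faces on the two sides of $e$. Let $\overline v^*$ be the vertex of $\overline G$ corresponding to the outer face. For a cycle $\sigma$ in $G$ and an edge $e=uv$ of $\sigma$, a complementary path $P_e^\sigma$ is a path from $u$ to $v$ in $G$, internally disjoint from $\sigma$, which together with $e$ forms the boundary of a face of $G$. The Expansion Algorithm starts with $\sigma_0$, the boundary of the outer face (this boundary has to be a cycle, otherwise the algorithm cannot start). As long as some edge $e_i$ of $\sigma_i$ has a complementary path, it chooses such an edge and path and sets $\sigma_{i+1}=\sigma_i+P_{e_i}^{\sigma_i}-e_i$; it stops when no complementary path exists. If $e_0,e_1,\dots$ are the edges chosen in a complete run, the run produces the subgraph $\overline T$ of $\overline G$ consisting of the vertex $\overline v^*$ and the dual edges $\overline e_0,\overline e_1,\dots$ together with their ends. Then every $\overline T$ produced by a run of the algorithm is a tree in $\overline G$ containing the root $\overline v^*$. Moreover, $G$ has a Hamiltonian cycle if and only if some run of the Expansion Algorithm produces a tree $\overline T$ with the following two properties.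 1. Every vertex of $G$ lies on the boundary of at least one face whose dual vertex is in $\overline T$. 2. If two distinct vertices of $\overline T$ are joined by an edge $\overline e$ of $\overline G$, then $\overline e$ belongs to $\overline T$ (so $\overline T$ is an induced subtree). -/

import Mathlib

/-! ### Multigraphs: connectedness, cycles, trees -/

namespace Graph

variable {α β : Type*}

/-- A multigraph is connected if it has a vertex and any two of its vertices are joined by a
walk. -/
def IsConnected (T : Graph α β) : Prop :=
  T.vertexSet.Nonempty ∧
    ∀ x ∈ T.vertexSet, ∀ y ∈ T.vertexSet, Relation.ReflTransGen T.Adj x y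

/-- The distinct vertices `v 0, …, v (n - 1)` and the distinct edges `e 0, …, e (n - 1)` form a
cycle of length `n ≥ 1`: the edge `e i` joins `v i` to `v (i + 1)`, indices modulo `n`.
A loop is a cycle of length one, two parallel edges form a cycle of length two. -/
structure IsCycleSeq (T : Graph α β) {n : ℕ} [NeZero n] (v : Fin n → α) (e : Fin n → β) :
    Prop where
  vertex_injective : Function.Injective v
  edge_injective : Function.Injective e
  isLink : ∀ i, T.IsLink (e i) (v i) (v (i + 1))

/-- A tree is a connected multigraph without cycles. -/
def IsTree (T : Graph α β) : Prop :=
  T.IsConnected ∧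
    ∀ (n : ℕ) [NeZero n] (v : Fin n → α) (e : Fin n → β), ¬ T.IsCycleSeq v e

end Graph

/-! ### Plane graphs -/

namespace SimpleGraph

variable {V : Type*}

/-- A plane embedding of a (finite connected) graph, given by its rotation system: a
permutation of the darts (oriented edges) which, for every vertex `v`, permutes the darts leaving
`v` in one cycle (their cyclic order around `v`). The faces are the cycles of the permutation that
sends a dart `d` to the dart following the reverse of `d` in the rotation at the head of `d`.
The embedding is in the plane (equivalently, the sphere) exactly if Euler's
formula `|V| - |E| + |F| = 2` holds. -/
structure PlaneEmbedding (G : SimpleGraph V) where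
  /-- the next dart around the same vertex -/
  rot : Equiv.Perm G.Dart
  rot_fst : ∀ d : G.Dart, (rot d).fst = d.fst
  rot_sameCycle : ∀ d d' : G.Dart, d.fst = d'.fst → rot.SameCycle d d'
  euler : Nat.card V +
      Nat.card (Quotient (Equiv.Perm.SameCycle.setoid
        ((Function.Involutive.toPerm Dart.symm Dart.symm_involutive).trans rot))) =
    Nat.card G.edgeSet + 2

namespace PlaneEmbedding

variable {G : SimpleGraph V} (M : G.PlaneEmbedding)

/-- The permutation that moves a dart one step along the boundary of the face beside it. -/
def facePerm : Equiv.Perm G.Dart :=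
  (Function.Involutive.toPerm Dart.symm Dart.symm_involutive).trans M.rot

/-- The faces of the plane graph. -/
def Face : Type _ := Quotient (Equiv.Perm.SameCycle.setoid M.facePerm)

/-- The face beside a dart; the face on the other side of the edge is `M.face d.symm`. -/
def face (d : G.Dart) : M.Face := Quotient.mk _ d

/-- The boundary of a face: the subgraph formed by the vertices and edges incident with it. -/
def boundary (f : M.Face) : G.Subgraph where
  verts := {v | ∃ d : G.Dart, M.face d = f ∧ v ∈ d.edge}
  Adj u v := ∃ d : G.Dart, M.face d = f ∧ d.edge = s(u, v)
  adj_sub := by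
    rintro u v ⟨d, -, hd⟩
    have h := d.edge_mem
    rwa [hd, mem_edgeSet] at h
  edge_vert := by
    rintro u v ⟨d, hf, hd⟩
    exact ⟨d, hf, by simp [hd]⟩
  symm := ⟨by
    rintro u v ⟨d, hf, hd⟩
    exact ⟨d, hf, by rw [hd, Sym2.eq_swap]⟩⟩

/-- The dual multigraph: its vertices are the faces, its edges are the edges of `G`, and an edge
joins the faces on its two sides. -/
def dual : Graph M.Face (Sym2 V) where
  vertexSet := Set.univ
  IsLink e f g := ∃ d : G.Dart, d.edge = e ∧ M.face d = f ∧ M.face d.symm = g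
  edgeSet := G.edgeSet
  isLink_symm := fun e _ => ⟨by
    rintro f g ⟨d, he, hf, hg⟩
    exact ⟨d.symm, by rw [Dart.edge_symm, he], hg, by rw [Dart.symm_symm, hf]⟩⟩
  eq_or_eq_of_isLink_of_isLink := by
    rintro e f g f' g' ⟨d, rfl, rfl, rfl⟩ ⟨d', he, rfl, rfl⟩
    rcases (dart_edge_eq_iff d' d).1 he with rfl | rfl
    · exact Or.inl rfl
    · exact Or.inr (by rw [Dart.symm_symm])
  edge_mem_iff_exists_isLink := by
    intro e
    constructor
    · intro he
      induction e with
      | _ u v => exact ⟨_, _, ⟨(u, v), he⟩, rfl, rfl, rfl⟩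
    · rintro ⟨f, g, d, rfl, -, -⟩
      exact d.edge_mem
  left_mem_of_isLink := fun _ _ _ _ => Set.mem_univ _

/-! ### The Expansion Algorithm -/

/-- `p` is a complementary path for the edge `e = uv` of `σ`: a path joining the ends of `e`,
internally disjoint from `σ`, that together with `e` forms the boundary of a face. -/
structure IsComplementaryPath (σ : G.Subgraph) {u v : V} (p : G.Walk u v) : Prop where
  adj : σ.Adj u v
  isPath : p.IsPath
  internally_disjoint : ∀ w ∈ p.support, w ∈ σ.verts → w = u ∨ w = v
  face_boundary : ∃ f : M.Face, M.boundary f = p.toSubgraph ⊔ G.subgraphOfAdj adj.adj_sub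

/-- `M.Run outer es σ`: some sequence of choices in the Expansion Algorithm, started at the outer
facial cycle, has used the edges `es` (in this order) and has reached `σ`.
The start requires that the boundary of the outer face is a cycle;
a step replaces `σ` by `σ + P - e` for an edge `e` of `σ` and a complementary path `P` of `e`. -/
inductive Run (outer : M.Face) : List (Sym2 V) → G.Subgraph → Prop
  | start (h : ∃ (a : V) (c : G.Walk a a), c.IsCycle ∧ c.toSubgraph = M.boundary outer) :
      Run outer [] (M.boundary outer)
  | step {es : List (Sym2 V)} {σ : G.Subgraph} {u v : V} {p : G.Walk u v}
      (hr : Run outer es σ) (hp : M.IsComplementaryPath σ p) :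
      Run outer (es ++ [s(u, v)]) ((σ ⊔ p.toSubgraph).deleteEdges {s(u, v)})

/-- The subgraph of the dual formed by the root `outer` and by the dual edges of `es` with their
ends. -/
def dualUnion (outer : M.Face) (es : List (Sym2 V)) : Graph M.Face (Sym2 V) :=
  (M.dual.restrict {e | e ∈ es}).induce ({outer} ∪ {f | ∃ e ∈ es, M.dual.Inc e f})

/-- `T` is found by the Expansion Algorithm: some run of the algorithm terminates (no
complementary path is left), and `T` consists of the root `outer` and the dual edges of the edges
chosen in that run. -/
def Produces (outer : M.Face) (T : Graph M.Face (Sym2 V)) : Prop :=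
  ∃ (es : List (Sym2 V)) (σ : G.Subgraph), M.Run outer es σ ∧
    (∀ (u v : V) (p : G.Walk u v), ¬ M.IsComplementaryPath σ p) ∧
    T = M.dualUnion outer es

end PlaneEmbedding

end SimpleGraph

/-!
Every step of the Expansion Algorithm glues one more face to the outer one. `Frontier` records what
the steps preserve: `σ` carries exactly the vertices of the absorbed faces, and it contains every
edge between an absorbed and another face, while each of its edges has an absorbed face beside it.
A complementary path has an interior vertex off `σ`, so the face it closes up is new and only the
dual edge of the chosen edge ties it to the absorbed ones: the dual edges form a tree that grows by
leaves (`Run.isTree`). Replacing the edge by the path keeps `σ` a cycle (`Run.exists_isCycle`), so a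
run whose faces cover all vertices has reached a Hamiltonian cycle (`Run.isHamiltonian`).

Conversely, let `H` be the edge set of a Hamiltonian cycle. Walking along it, the faces on its left
are the same or adjacent across a chord, and so are those on its right; since every face has an edge
on `H`, the dual without `H` has at most two components. It has `|F|` vertices and
`|E| - |V| = |F| - 2` edges by Euler's formula, so it has exactly two components, which `H`
separates, and every chord is a bridge of it (`HamiltonianCut`). Hence no face lies on both sides of
an edge, so all facial boundaries are cycles, and as long as some face on the outer side of `H` is
not absorbed, one of them is adjacent to an absorbed face across a chord. The rest of its boundary
is a complementary path: an interior vertex on `σ` would yield a second connection to the absorbed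
faces, against the chords being bridges. In this way the run absorbs precisely the outer side of
`H`, which meets all vertices and induces a tree in the dual.
-/

/-! ### Darts and faces of a cubic plane graph -/

namespace SimpleGraph.PlaneEmbedding

variable {V : Type*} {G : SimpleGraph V} (M : G.PlaneEmbedding)

theorem facePerm_apply (d : G.Dart) : M.facePerm d = M.rot d.symm := rfl

theorem facePerm_symm_apply (d : G.Dart) : M.facePerm d.symm = M.rot d := by
  rw [facePerm_apply, Dart.symm_symm]

theorem facePerm_fst (d : G.Dart) : (M.facePerm d).fst = d.snd := by
  rw [facePerm_apply, M.rot_fst]; rfl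

theorem face_eq_iff {d d' : G.Dart} : M.face d = M.face d' ↔ M.facePerm.SameCycle d d' :=
  Quotient.eq

theorem face_facePerm (d : G.Dart) : M.face (M.facePerm d) = M.face d :=
  M.face_eq_iff.2 (Equiv.Perm.sameCycle_apply_left.2 (Equiv.Perm.SameCycle.refl _ _))

theorem face_rot (d : G.Dart) : M.face (M.rot d) = M.face d.symm := by
  rw [← facePerm_symm_apply, face_facePerm]

theorem exists_face_eq (f : M.Face) : ∃ d, M.face d = f := Quotient.exists_rep f

instance [Finite V] : Finite G.Dart := Finite.of_injective _ (Dart.toProd_injective (G := G))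

instance [Finite V] : Finite M.Face := by
  exact Quotient.finite _

theorem dart_ext {d d' : G.Dart} (h₁ : d.fst = d'.fst) (h₂ : d.snd = d'.snd) : d = d' :=
  Dart.ext _ _ (Prod.ext h₁ h₂)

theorem mem_boundary_fst (d : G.Dart) : d.fst ∈ (M.boundary (M.face d)).verts :=
  ⟨d, rfl, by simp [Dart.edge]⟩

theorem mem_verts_boundary {f : M.Face} {v : V} :
    v ∈ (M.boundary f).verts ↔ ∃ d : G.Dart, M.face d = f ∧ d.fst = v := by
  constructor
  · rintro ⟨d, hd, hv⟩
    rcases Sym2.mem_iff.1 hv with rfl | rfl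
    · exact ⟨d, hd, rfl⟩
    · exact ⟨M.facePerm d, by rw [face_facePerm, hd], M.facePerm_fst d⟩
  · rintro ⟨d, rfl, rfl⟩
    exact M.mem_boundary_fst d

section Cubic

variable [G.LocallyFinite] (hcubic : G.IsRegularOfDegree 3)

include hcubic

/-- The three neighbours of a vertex of a cubic graph. -/
theorem exists_three_neighbors (v : V) : ∃ x y z, x ≠ y ∧ x ≠ z ∧ y ≠ z ∧
    ∀ w, G.Adj v w ↔ w = x ∨ w = y ∨ w = z := by
  classical
  obtain ⟨x, y, z, hxy, hxz, hyz, h⟩ := Finset.card_eq_three.1 (hcubic v)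
  refine ⟨x, y, z, hxy, hxz, hyz, fun w => ?_⟩
  rw [← mem_neighborFinset, h]
  simp

theorem rot_ne_self (d : G.Dart) : M.rot d ≠ d := by
  intro h
  obtain ⟨x, y, z, hxy, -, -, hN⟩ := exists_three_neighbors hcubic d.fst
  have key : ∀ w, G.Adj d.fst w → d.snd = w := by
    intro w hw
    obtain ⟨i, hi⟩ := M.rot_sameCycle d ⟨(d.fst, w), hw⟩ rfl
    rw [Equiv.Perm.zpow_apply_eq_self_of_apply_eq_self h] at hi
    rw [hi]
  exact hxy ((key x ((hN x).2 (by simp))).symm.trans (key y ((hN y).2 (by simp))))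

theorem rot_rot_ne_self (d : G.Dart) : M.rot (M.rot d) ≠ d := by
  intro h
  obtain ⟨x, y, z, hxy, hxz, hyz, hN⟩ := exists_three_neighbors hcubic d.fst
  have key : ∀ w, G.Adj d.fst w → d.snd = w ∨ (M.rot d).snd = w := by
    intro w hw
    obtain ⟨i, hi⟩ := M.rot_sameCycle d ⟨(d.fst, w), hw⟩ rfl
    rcases Equiv.Perm.zpow_apply_eq_of_apply_apply_eq_self h i with h' | h'
    · rw [h'] at hi; left; rw [hi]
    · rw [h'] at hi; right; rw [hi]
  have hx := key x ((hN x).2 (by simp))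
  have hy := key y ((hN y).2 (by simp))
  have hz := key z ((hN z).2 (by simp))
  grind

/-- The rotation runs through the three darts at a vertex. -/
theorem dart_eq_of_fst_eq {d d' : G.Dart} (h : d'.fst = d.fst) :
    d' = d ∨ d' = M.rot d ∨ d' = M.rot (M.rot d) := by
  obtain ⟨x, y, z, hxy, hxz, hyz, hN⟩ := exists_three_neighbors hcubic d.fst
  have h₁ := M.rot_ne_self hcubic d
  have h₂ := M.rot_rot_ne_self hcubic d
  have h₃ := M.rot_ne_self hcubic (M.rot d)
  have hs : ∀ a b : G.Dart, a.fst = d.fst → b.fst = d.fst → a.snd = b.snd → a = b :=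
    fun a b ha hb h => dart_ext (ha.trans hb.symm) h
  have hn : ∀ a : G.Dart, a.fst = d.fst → a.snd = x ∨ a.snd = y ∨ a.snd = z :=
    fun a ha => (hN _).1 (ha ▸ a.adj)
  have f₁ : (M.rot d).fst = d.fst := M.rot_fst d
  have f₂ : (M.rot (M.rot d)).fst = d.fst := (M.rot_fst _).trans f₁
  have a₀ := hn d rfl
  have a₁ := hn _ f₁
  have a₂ := hn _ f₂
  have a₃ := hn _ h
  have b₁ := mt (hs _ _ f₁ rfl) h₁
  have b₂ := mt (hs _ _ f₂ rfl) h₂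
  have b₃ := mt (hs _ _ f₂ f₁) h₃
  have c₁ := hs _ _ h rfl
  have c₂ := hs _ _ h f₁
  have c₃ := hs _ _ h f₂
  grind

theorem rot_rot_rot (d : G.Dart) : M.rot (M.rot (M.rot d)) = d := by
  have hf : (M.rot (M.rot (M.rot d))).fst = d.fst := by simp only [M.rot_fst]
  rcases M.dart_eq_of_fst_eq hcubic hf with h | h | h
  · exact h
  · exact absurd (M.rot.injective h) (M.rot_rot_ne_self hcubic d)
  · exact absurd h (M.rot_ne_self hcubic _)

/-- A face boundary is never a single edge: after the edge `uv` it leaves `v` towards a third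
vertex. -/
theorem exists_mem_boundary_ne {f : M.Face} {u v : V} (h : (M.boundary f).Adj u v) :
    ∃ w ∈ (M.boundary f).verts, w ≠ u ∧ w ≠ v := by
  have key : ∀ d : G.Dart, M.face d = f → ∃ w ∈ (M.boundary f).verts, w ≠ d.fst ∧ w ≠ d.snd := by
    intro d hd
    refine ⟨(M.facePerm d).snd, M.mem_verts_boundary.2 ⟨M.facePerm (M.facePerm d), ?_, ?_⟩, ?_, ?_⟩
    · rw [face_facePerm, face_facePerm, hd]
    · rw [facePerm_fst]
    · intro hw
      exact M.rot_ne_self hcubic d.symm (dart_ext (M.rot_fst _) hw)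
    · rw [← M.facePerm_fst d]
      exact (M.facePerm d).snd_ne_fst
  obtain ⟨d, hd, he⟩ := h
  obtain ⟨w, hw, h₁, h₂⟩ := key d hd
  have hu : u = d.fst ∧ v = d.snd ∨ u = d.snd ∧ v = d.fst := by
    have : s(d.fst, d.snd) = s(u, v) := he
    rw [Sym2.eq_iff] at this
    tauto
  rcases hu with ⟨rfl, rfl⟩ | ⟨rfl, rfl⟩
  · exact ⟨w, hw, h₁, h₂⟩
  · exact ⟨w, hw, h₂, h₁⟩

end Cubic

end SimpleGraph.PlaneEmbedding

/-! ### The faces absorbed by a run -/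

namespace SimpleGraph.PlaneEmbedding

variable {V : Type*} {G : SimpleGraph V} (M : G.PlaneEmbedding)

/-- The faces absorbed by a run that used the edges `es`: the outer face and the faces beside the
edges of `es`. -/
def absorbed (outer : M.Face) (es : List (Sym2 V)) : Set M.Face :=
  {outer} ∪ {f | ∃ e ∈ es, M.dual.Inc e f}

variable {M} {outer : M.Face} {es : List (Sym2 V)} {σ : G.Subgraph}

theorem dual_isLink_dart (d : G.Dart) : M.dual.IsLink d.edge (M.face d) (M.face d.symm) :=
  ⟨d, rfl, rfl, rfl⟩

theorem outer_mem_absorbed : outer ∈ M.absorbed outer es := Or.inl rfl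

theorem vertexSet_dualUnion : (M.dualUnion outer es).vertexSet = M.absorbed outer es := rfl

theorem dualUnion_isLink {e : Sym2 V} {f g : M.Face} :
    (M.dualUnion outer es).IsLink e f g ↔ e ∈ es ∧ M.dual.IsLink e f g := by
  constructor
  · rintro ⟨⟨he, h⟩, -, -⟩
    exact ⟨he, h⟩
  · rintro ⟨he, h⟩
    exact ⟨⟨he, h⟩, Or.inr ⟨e, he, g, h⟩, Or.inr ⟨e, he, f, h.symm⟩⟩

theorem dualUnion_le_dual : M.dualUnion outer es ≤ M.dual :=
  ⟨fun _ _ => Set.mem_univ _, fun _ _ _ h => (dualUnion_isLink.1 h).2⟩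

theorem absorbed_nil : M.absorbed outer [] = {outer} := by
  simp [absorbed]

/-- Absorbing the face on the far side of an edge next to an absorbed face. -/
theorem absorbed_append {d : G.Dart} (hd : M.face d.symm ∈ M.absorbed outer es) :
    M.absorbed outer (es ++ [d.edge]) = insert (M.face d) (M.absorbed outer es) := by
  ext f
  constructor
  · rintro (rfl | ⟨e, he, hf⟩)
    · exact Or.inr outer_mem_absorbed
    · rcases List.mem_append.1 he with he | he
      · exact Or.inr (Or.inr ⟨e, he, hf⟩)
      · obtain rfl := List.mem_singleton.1 he
        obtain ⟨g, hg⟩ := hf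
        rcases hg.left_eq_or_eq (dual_isLink_dart d) with rfl | rfl
        · exact Or.inl rfl
        · exact Or.inr hd
  · rintro (rfl | rfl | ⟨e, he, hf⟩)
    · exact Or.inr ⟨d.edge, by simp, _, dual_isLink_dart d⟩
    · exact outer_mem_absorbed
    · exact Or.inr ⟨e, by simp [he], hf⟩

/-- The invariant of the Expansion Algorithm: `σ` carries exactly the vertices of the absorbed
faces, every edge of `σ` lies beside an absorbed face, and every edge between an absorbed face
and another face belongs to `σ`. -/
structure Frontier (outer : M.Face) (es : List (Sym2 V)) (σ : G.Subgraph) : Prop where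
  mem_verts_iff : ∀ v, v ∈ σ.verts ↔ ∃ f ∈ M.absorbed outer es, v ∈ (M.boundary f).verts
  exists_side : ∀ d : G.Dart, σ.Adj d.fst d.snd →
    M.face d ∈ M.absorbed outer es ∨ M.face d.symm ∈ M.absorbed outer es
  adj_of_sides : ∀ d : G.Dart, M.face d ∈ M.absorbed outer es →
    M.face d.symm ∉ M.absorbed outer es → σ.Adj d.fst d.snd

theorem boundary_adj_iff {f : M.Face} {d : G.Dart} :
    (M.boundary f).Adj d.fst d.snd ↔ M.face d = f ∨ M.face d.symm = f := by
  constructor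
  · rintro ⟨d', hf, he⟩
    rcases (dart_edge_eq_iff d' d).1 he with rfl | rfl
    · exact Or.inl hf
    · exact Or.inr hf
  · rintro (h | h)
    · exact ⟨d, h, rfl⟩
    · exact ⟨d.symm, h, d.edge_symm⟩

theorem frontier_start : M.Frontier outer [] (M.boundary outer) := by
  refine ⟨?_, ?_, ?_⟩ <;> simp only [absorbed_nil]
  · simp
  · exact fun d h => boundary_adj_iff.1 h
  · exact fun d h _ => boundary_adj_iff.2 (Or.inl h)

section Cubic

variable [G.LocallyFinite] (hcubic : G.IsRegularOfDegree 3)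

include hcubic

/-- A complementary path has an interior vertex, as no face boundary is a single edge. -/
theorem IsComplementaryPath.exists_not_mem {u v : V} {p : G.Walk u v}
    (hp : M.IsComplementaryPath σ p) : ∃ w ∈ p.support, w ∉ σ.verts := by
  obtain ⟨f, hf⟩ := hp.face_boundary
  have hadj : (M.boundary f).Adj u v := by rw [hf]; right; simp
  obtain ⟨w, hw, hu, hv⟩ := M.exists_mem_boundary_ne hcubic hadj
  rw [hf] at hw
  rcases hw with hw | hw
  · rw [Walk.mem_verts_toSubgraph] at hw
    exact ⟨w, hw, fun h => (hp.internally_disjoint w hw h).elim hu hv⟩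
  · rcases hw with hw | hw
    · exact absurd hw hu
    · exact absurd hw hv

/-- A complementary path closes up a face that has not been absorbed yet, across an edge whose
other side has been absorbed. -/
theorem IsComplementaryPath.exists_dart {u v : V} {p : G.Walk u v}
    (hp : M.IsComplementaryPath σ p) (hI : M.Frontier outer es σ) :
    ∃ d : G.Dart, d.edge = s(u, v) ∧ M.face d ∉ M.absorbed outer es ∧
      M.face d.symm ∈ M.absorbed outer es ∧
      M.boundary (M.face d) = p.toSubgraph ⊔ G.subgraphOfAdj hp.adj.adj_sub := by
  obtain ⟨f, hf⟩ := hp.face_boundary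
  have hadj : (M.boundary f).Adj u v := by rw [hf]; right; simp
  obtain ⟨d, rfl, hd⟩ := hadj
  have hnot : M.face d ∉ M.absorbed outer es := by
    intro h
    obtain ⟨w, hw, hws⟩ := hp.exists_not_mem hcubic
    refine hws ((hI.mem_verts_iff w).2 ⟨_, h, ?_⟩)
    rw [hf]
    exact Or.inl ((Walk.mem_verts_toSubgraph p).2 hw)
  have hσ : σ.Adj d.fst d.snd := by
    have : s(d.fst, d.snd) ∈ σ.edgeSet := by
      change d.edge ∈ _
      rw [hd]; exact hp.adj
    exact this
  exact ⟨d, hd, hnot, (hI.exists_side d hσ).resolve_left hnot, hf⟩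

theorem Frontier.step {u v : V} {p : G.Walk u v} (hI : M.Frontier outer es σ)
    (hp : M.IsComplementaryPath σ p) :
    M.Frontier outer (es ++ [s(u, v)]) ((σ ⊔ p.toSubgraph).deleteEdges {s(u, v)}) := by
  obtain ⟨d, hd, hnot, hside, hb⟩ := hp.exists_dart hcubic hI
  have hu : u ∈ σ.verts := hp.adj.fst_mem
  have hv : v ∈ σ.verts := hp.adj.snd_mem
  rw [← hd]
  constructor
  · intro w
    rw [absorbed_append hside, Set.exists_mem_insert, ← hI.mem_verts_iff, hb]
    simp only [Subgraph.deleteEdges_verts, Subgraph.verts_sup, Set.mem_union, subgraphOfAdj_verts,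
      Set.mem_insert_iff, Set.mem_singleton_iff]
    constructor
    · tauto
    · rintro ((h | rfl | rfl) | h) <;> tauto
  · intro x hx
    rw [absorbed_append hside]
    rw [Subgraph.deleteEdges_adj] at hx
    rcases hx.1 with h | h
    · exact (hI.exists_side x h).imp Or.inr Or.inr
    · have : (M.boundary (M.face d)).Adj x.fst x.snd := by rw [hb]; exact Or.inl h
      exact (boundary_adj_iff.1 this).imp Or.inl Or.inl
  · intro x h₁ h₂
    rw [absorbed_append hside] at h₁ h₂
    have hne : x.edge ≠ d.edge := by
      intro h
      rcases (dart_edge_eq_iff x d).1 h with rfl | rfl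
      · exact h₂ (Or.inr hside)
      · exact h₂ (Or.inl (by rw [Dart.symm_symm]))
    rw [Subgraph.deleteEdges_adj]
    refine ⟨?_, hne⟩
    rcases h₁ with h₁ | h₁
    · have := boundary_adj_iff.2 (Or.inl h₁)
      rw [hb] at this
      rcases this with h | h
      · exact Or.inr h
      · rw [subgraphOfAdj_adj, ← hd] at h
        exact absurd h.symm hne
    · exact Or.inl (hI.adj_of_sides x h₁ fun h => h₂ (Or.inr h))

theorem Run.frontier (h : M.Run outer es σ) : M.Frontier outer es σ := by
  induction h with
  | start _ => exact frontier_start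
  | step _ hp ih => exact ih.step hcubic hp

end Cubic

/-! ### The dual edges of a run form a tree -/

theorem isTree_dualUnion_nil : (M.dualUnion outer []).IsTree := by
  refine ⟨⟨⟨outer, outer_mem_absorbed⟩, ?_⟩, ?_⟩
  · rw [vertexSet_dualUnion, absorbed_nil]
    rintro _ rfl _ rfl
    exact .refl
  · intro n _ v e h
    exact absurd (dualUnion_isLink.1 (h.isLink 0)).1 List.not_mem_nil

/-- Absorbing a new face adds a leaf to the tree. -/
theorem isTree_dualUnion_append (hT : (M.dualUnion outer es).IsTree) {d : G.Dart}
    (hd : M.face d ∉ M.absorbed outer es) (hd' : M.face d.symm ∈ M.absorbed outer es) :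
    (M.dualUnion outer (es ++ [d.edge])).IsTree := by
  obtain ⟨⟨-, hconn⟩, hcyc⟩ := hT
  have hlink : (M.dualUnion outer (es ++ [d.edge])).IsLink d.edge (M.face d) (M.face d.symm) :=
    dualUnion_isLink.2 ⟨by simp, dual_isLink_dart d⟩
  have hmono : ∀ x y, Relation.ReflTransGen (M.dualUnion outer es).Adj x y →
      Relation.ReflTransGen (M.dualUnion outer (es ++ [d.edge])).Adj x y := by
    refine fun x y h => Relation.ReflTransGen.mono ?_ _ _ h
    rintro x y ⟨e, he⟩
    obtain ⟨h₁, h₂⟩ := dualUnion_isLink.1 he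
    exact ⟨e, dualUnion_isLink.2 ⟨by simp [h₁], h₂⟩⟩
  -- the new edge is the only edge at the new face
  have hleaf : ∀ e g, (M.dualUnion outer (es ++ [d.edge])).IsLink e (M.face d) g → e = d.edge := by
    intro e g h
    obtain ⟨h₁, h₂⟩ := dualUnion_isLink.1 h
    rcases List.mem_append.1 h₁ with h₁ | h₁
    · exact absurd (Or.inr ⟨e, h₁, g, h₂⟩) hd
    · exact List.mem_singleton.1 h₁
  refine ⟨⟨⟨outer, outer_mem_absorbed⟩, ?_⟩, ?_⟩
  · rw [vertexSet_dualUnion, absorbed_append hd']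
    rw [vertexSet_dualUnion] at hconn
    rintro x (rfl | hx) y (rfl | hy)
    · exact .refl
    · exact .head ⟨_, hlink⟩ (hmono _ _ (hconn _ hd' _ hy))
    · exact .tail (hmono _ _ (hconn _ hx _ hd')) ⟨_, hlink.symm⟩
    · exact hmono _ _ (hconn _ hx _ hy)
  · intro n _ v e h
    by_cases hv : ∃ j, v j = M.face d
    · obtain ⟨j, hj⟩ := hv
      have h₁ := h.isLink j
      have h₂ := h.isLink (j - 1)
      rw [sub_add_cancel] at h₂
      rw [hj] at h₁ h₂
      have hjj : j = j - 1 :=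
        h.edge_injective ((hleaf _ _ h₁).trans (hleaf _ _ h₂.symm).symm)
      -- the cycle has length one, so the new edge would be a loop
      rw [← hjj, hleaf _ _ h₁, hj] at h₂
      rcases hlink.eq_and_eq_or_eq_and_eq h₂ with ⟨-, h⟩ | ⟨-, h⟩ <;> exact hd (h ▸ hd')
    · push Not at hv
      refine hcyc n v e ⟨h.vertex_injective, h.edge_injective, fun i => ?_⟩
      obtain ⟨h₁, h₂⟩ := dualUnion_isLink.1 (h.isLink i)
      refine dualUnion_isLink.2 ⟨?_, h₂⟩
      rcases List.mem_append.1 h₁ with h₁ | h₁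
      · exact h₁
      · rw [List.mem_singleton.1 h₁] at h₂
        rcases h₂.eq_and_eq_or_eq_and_eq (dual_isLink_dart d) with ⟨h, -⟩ | ⟨-, h⟩
        · exact absurd h (hv i)
        · exact absurd h (hv _)

theorem Run.isTree [G.LocallyFinite] (hcubic : G.IsRegularOfDegree 3) (h : M.Run outer es σ) :
    (M.dualUnion outer es).IsTree := by
  induction h with
  | start _ => exact isTree_dualUnion_nil
  | step hr hp ih =>
    obtain ⟨d, hd, hnot, hside, -⟩ := hp.exists_dart hcubic (hr.frontier hcubic)
    rw [← hd]
    exact isTree_dualUnion_append ih hnot hside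

/-! ### The expanding cycle -/

/-- An edge `uv` of a cycle is completed to the cycle by a path from `v` to `u`. -/
theorem _root_.SimpleGraph.Walk.IsCycle.exists_isPath_compl {a u v : V}
    {c : G.Walk a a} (hc : c.IsCycle) (h : c.toSubgraph.Adj u v) :
    ∃ q : G.Walk v u, q.IsPath ∧ s(u, v) ∉ q.edges ∧
      c.toSubgraph = q.toSubgraph ⊔ G.subgraphOfAdj h.adj_sub := by
  classical
  have hu : u ∈ c.support := c.mem_support_of_adj_toSubgraph h
  have key : ∀ c' : G.Walk u u, c'.IsCycle → c'.toSubgraph = c.toSubgraph → c'.snd = v →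
      ∃ q : G.Walk v u, q.IsPath ∧ s(u, v) ∉ q.edges ∧
        c.toSubgraph = q.toSubgraph ⊔ G.subgraphOfAdj h.adj_sub := by
    intro c' hc' hs hv
    cases c' with
    | nil => exact absurd hc' Walk.not_isCycle_nil
    | cons hadj q =>
      rw [Walk.snd_cons] at hv
      subst hv
      rw [Walk.cons_isCycle_iff] at hc'
      exact ⟨q, hc'.1, hc'.2, hs.symm.trans (sup_comm _ _)⟩
  have hc₁ : (c.rotate u hu).IsCycle := hc.rotate hu
  have hs₁ : (c.rotate u hu).toSubgraph = c.toSubgraph := c.toSubgraph_rotate hu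
  have hv : v ∈ (c.rotate u hu).toSubgraph.neighborSet u := by rw [hs₁]; exact h
  rw [hc₁.neighborSet_toSubgraph_endpoint] at hv
  rcases hv with hv | hv
  · exact key _ hc₁ hs₁ hv.symm
  · refine key _ hc₁.reverse (by rw [Walk.toSubgraph_reverse, hs₁]) ?_
    rw [Walk.snd_reverse]; exact hv.symm

/-- Two paths with only their ends in common form a cycle if the second one is not the edge `uv`
between their ends and the first one has an interior vertex; then `uv` is not on the cycle. -/
theorem _root_.SimpleGraph.Walk.IsPath.isCycle_append_of_interior {u v : V}
    {p : G.Walk u v} {q : G.Walk v u}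
    (hp : p.IsPath) (hq : q.IsPath) (hpq : ∀ x ∈ p.support, x ∈ q.support → x = u ∨ x = v)
    (huv : s(u, v) ∉ q.edges) (hint : ¬ ∀ x ∈ p.support, x = u ∨ x = v) :
    (p.append q).IsCycle ∧ s(u, v) ∉ p.edges := by
  cases p with
  | nil => exact absurd (by simp) hint
  | @cons _ x _ h p =>
    rw [Walk.cons_isPath_iff] at hp
    obtain ⟨hp, hu⟩ := hp
    constructor
    · rw [Walk.cons_append, Walk.cons_isCycle_iff, Walk.isPath_def, Walk.support_append,
        List.nodup_append', Walk.edges_append, List.mem_append]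
      have hqs := hq.support_nodup
      rw [← Walk.cons_tail_support, List.nodup_cons] at hqs
      refine ⟨⟨hp.support_nodup, hqs.2, fun y hy hy' => ?_⟩, ?_⟩
      · rcases hpq y (by simp [hy]) (List.mem_of_mem_tail hy') with rfl | rfl
        · exact hu hy
        · exact hqs.1 hy'
      · rintro (h' | h')
        · exact hu (p.fst_mem_support_of_mem_edges h')
        · rcases hpq x (by simp) (q.snd_mem_support_of_mem_edges h') with rfl | rfl
          · exact h.ne rfl
          · exact huv h'
    · rw [Walk.edges_cons, List.mem_cons]
      rintro (h' | h')
      · obtain rfl : v = x := by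
          rcases Sym2.eq_iff.1 h' with ⟨-, h'⟩ | ⟨h', -⟩
          · exact h'
          · exact absurd h' h.ne
        obtain rfl := (Walk.isPath_iff_nil.1 hp).eq_nil
        exact hint (by simp)
      · exact hu (p.fst_mem_support_of_mem_edges h')

/-- The subgraph reached by a run is a cycle. -/
theorem Run.exists_isCycle [G.LocallyFinite] (hcubic : G.IsRegularOfDegree 3)
    (h : M.Run outer es σ) : ∃ (a : V) (c : G.Walk a a), c.IsCycle ∧ c.toSubgraph = σ := by
  induction h with
  | start h => exact h
  | @step es σ u v p hr hp ih =>
    obtain ⟨a, c, hc, rfl⟩ := ih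
    obtain ⟨q, hq, huv, hs⟩ := hc.exists_isPath_compl hp.adj
    obtain ⟨w, hw, hwσ⟩ := hp.exists_not_mem hcubic
    have hc' : ∀ x, x ∈ q.support → x ∈ c.toSubgraph.verts := fun x hx => by
      rw [hs]; exact Or.inl ((Walk.mem_verts_toSubgraph q).2 hx)
    obtain ⟨hcyc, hp'⟩ := hp.isPath.isCycle_append_of_interior hq
      (fun x hx hx' => hp.internally_disjoint x hx (hc' x hx')) huv
      (fun h => hwσ (hc' w (by
        rcases h w hw with rfl | rfl
        · exact q.end_mem_support
        · exact q.start_mem_support)))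
    refine ⟨u, p.append q, hcyc, ?_⟩
    rw [hs, Walk.toSubgraph_append]
    refine Subgraph.ext ?_ ?_
    · ext x
      have h₁ : u ∈ q.toSubgraph.verts := q.end_mem_verts_toSubgraph
      have h₂ : v ∈ q.toSubgraph.verts := q.start_mem_verts_toSubgraph
      simp only [Subgraph.deleteEdges_verts, Subgraph.verts_sup, Set.mem_union,
        subgraphOfAdj_verts, Set.mem_insert_iff, Set.mem_singleton_iff]
      constructor
      · tauto
      · rintro ((h | rfl | rfl) | h) <;> tauto
    · ext x y
      simp only [Subgraph.deleteEdges_adj, Subgraph.sup_adj, subgraphOfAdj_adj,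
        Walk.adj_toSubgraph_iff_mem_edges, Set.mem_singleton_iff]
      have h₁ : s(x, y) ∈ p.edges → s(x, y) ≠ s(u, v) := fun h h' => hp' (h' ▸ h)
      have h₂ : s(x, y) ∈ q.edges → s(x, y) ≠ s(u, v) := fun h h' => huv (h' ▸ h)
      have h₃ : s(u, v) = s(x, y) → s(x, y) = s(u, v) := Eq.symm
      tauto

end SimpleGraph.PlaneEmbedding

/-! ### Facial cycles -/

namespace SimpleGraph.PlaneEmbedding

variable {V : Type*} {G : SimpleGraph V} (M : G.PlaneEmbedding)

/-- The walk along the first `n` darts of the face beside `d`, starting with `d`. -/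
def faceWalk (d : G.Dart) : ∀ n : ℕ, G.Walk d.fst (M.facePerm^[n] d).fst
  | 0 => .nil
  | n + 1 => (faceWalk d n).concat <| by
      rw [Function.iterate_succ_apply', facePerm_fst]
      exact (M.facePerm^[n] d).adj

theorem support_faceWalk (d : G.Dart) (n : ℕ) :
    (M.faceWalk d n).support = (List.range (n + 1)).map fun i => (M.facePerm^[i] d).fst := by
  induction n with
  | zero => rfl
  | succ n ih =>
    rw [faceWalk, Walk.support_concat, ih, List.range_succ (n := n + 1), List.map_append]
    rfl

theorem edges_faceWalk (d : G.Dart) (n : ℕ) :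
    (M.faceWalk d n).edges = (List.range n).map fun i => (M.facePerm^[i] d).edge := by
  induction n with
  | zero => rfl
  | succ n ih =>
    rw [faceWalk, Walk.edges_concat, ih, List.range_succ, List.map_append, List.concat_eq_append,
      Function.iterate_succ_apply', facePerm_fst]
    rfl

theorem face_iterate_facePerm (d : G.Dart) (n : ℕ) : M.face (M.facePerm^[n] d) = M.face d := by
  induction n with
  | zero => rfl
  | succ n ih => rw [Function.iterate_succ_apply', face_facePerm, ih]

/-- If a face meets every vertex at most once and lies on one side only of each of its edges,
then its boundary is a cycle: every edge is completed to the boundary by a path. -/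
theorem exists_isPath_boundary [Finite V]
    (hinj : ∀ x y : G.Dart, M.face x = M.face y → x.fst = y.fst → x = y)
    (hbr : ∀ x : G.Dart, M.face x ≠ M.face x.symm) (d : G.Dart) :
    ∃ q : G.Walk d.snd d.fst, q.IsPath ∧ d.edge ∉ q.edges ∧
      M.boundary (M.face d) = q.toSubgraph ⊔ G.subgraphOfAdj d.adj.symm := by
  set d₁ := M.facePerm d with hd₁
  set k := Function.minimalPeriod M.facePerm d₁ with hk
  have hkpos : 0 < k := Function.minimalPeriod_pos_of_mem_periodicPts
    (M.facePerm.injective.mem_periodicPts d₁)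
  have hlt : ∀ i j, i < k → j < k → M.facePerm^[i] d₁ = M.facePerm^[j] d₁ → i = j :=
    fun i j hi hj h => Function.iterate_injOn_Iio_minimalPeriod hi hj h
  have hface : M.face d₁ = M.face d := M.face_facePerm d
  have hex : ∀ x, M.face x = M.face d → ∃ i < k, M.facePerm^[i] d₁ = x := by
    intro x hx
    obtain ⟨n, hn⟩ := (M.face_eq_iff.1 (hface.trans hx.symm)).exists_nat_pow_eq
    refine ⟨n % k, Nat.mod_lt _ hkpos, ?_⟩
    rw [Function.iterate_mod_minimalPeriod_eq, Equiv.Perm.iterate_eq_pow, hn]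
  have hlast : M.facePerm^[k - 1] d₁ = d := by
    apply M.facePerm.injective
    rw [← Function.iterate_succ_apply' M.facePerm, Nat.succ_eq_add_one, Nat.sub_add_cancel hkpos,
      Function.iterate_minimalPeriod]
  have hk1 : k - 1 + 1 = k := Nat.sub_add_cancel hkpos
  refine ⟨(M.faceWalk d₁ (k - 1)).copy (M.facePerm_fst d) (by rw [hlast]), ?_, ?_, ?_⟩
  · rw [Walk.isPath_def, Walk.support_copy, support_faceWalk, hk1]
    refine List.Nodup.map_on ?_ List.nodup_range
    intro i hi j hj h
    refine hlt i j (List.mem_range.1 hi) (List.mem_range.1 hj) (hinj _ _ ?_ h)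
    rw [face_iterate_facePerm, face_iterate_facePerm]
  · rw [Walk.edges_copy, edges_faceWalk, List.mem_map]
    rintro ⟨i, hi, h⟩
    have hi := List.mem_range.1 hi
    rcases (dart_edge_eq_iff _ _).1 h with h | h
    · have := hlt i (k - 1) (by omega) (by omega) (h.trans hlast.symm)
      omega
    · refine hbr d ?_
      rw [← h, face_iterate_facePerm, hface]
  · refine Subgraph.ext ?_ ?_
    · ext v
      rw [mem_verts_boundary, Subgraph.verts_sup, Set.mem_union, Walk.mem_verts_toSubgraph,
        Walk.support_copy, support_faceWalk, hk1, List.mem_map]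
      constructor
      · rintro ⟨x, hx, rfl⟩
        obtain ⟨i, hi, rfl⟩ := hex x hx
        exact Or.inl ⟨i, List.mem_range.2 hi, rfl⟩
      · rintro (⟨i, -, rfl⟩ | rfl | rfl)
        · exact ⟨_, (M.face_iterate_facePerm _ _).trans hface, rfl⟩
        · exact ⟨d₁, hface, M.facePerm_fst d⟩
        · exact ⟨d, rfl, rfl⟩
    · ext a b
      rw [Subgraph.sup_adj, Walk.adj_toSubgraph_iff_mem_edges, Walk.edges_copy, edges_faceWalk,
        List.mem_map]
      constructor
      · rintro ⟨x, hx, he⟩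
        obtain ⟨i, hi, rfl⟩ := hex x hx
        rcases (Nat.le_sub_one_of_lt hi).lt_or_eq with h | rfl
        · exact Or.inl ⟨i, List.mem_range.2 h, he⟩
        · right
          rw [hlast] at he
          rw [subgraphOfAdj_adj, ← he, Sym2.eq_swap]
          rfl
      · rintro (⟨i, -, he⟩ | h)
        · exact ⟨_, (M.face_iterate_facePerm _ _).trans hface, he⟩
        · rw [subgraphOfAdj_adj, Sym2.eq_swap] at h
          exact ⟨d, rfl, h⟩

end SimpleGraph.PlaneEmbedding

/-! ### The two sides of a Hamiltonian cycle -/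

namespace SimpleGraph.PlaneEmbedding

variable {V : Type*} {G : SimpleGraph V} (M : G.PlaneEmbedding)

/-- Two faces are joined by `D` if one can walk in the dual from one to the other using only dual
edges of edges in `D`. -/
def Joined (D : Set (Sym2 V)) : M.Face → M.Face → Prop :=
  Relation.ReflTransGen fun f g => ∃ d : G.Dart, d.edge ∈ D ∧ M.face d = f ∧ M.face d.symm = g

variable {M} {D D' : Set (Sym2 V)} {f g h : M.Face}

theorem joined_dart {d : G.Dart} (hd : d.edge ∈ D) : M.Joined D (M.face d) (M.face d.symm) :=
  .single ⟨d, hd, rfl, rfl⟩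

theorem Joined.trans (h₁ : M.Joined D f g) (h₂ : M.Joined D g h) : M.Joined D f h :=
  Relation.ReflTransGen.trans h₁ h₂

theorem Joined.symm (h : M.Joined D f g) : M.Joined D g f := by
  induction h with
  | refl => exact .refl
  | tail _ h ih =>
    obtain ⟨d, hd, rfl, rfl⟩ := h
    exact Relation.ReflTransGen.head ⟨d.symm, by rwa [Dart.edge_symm], rfl, by rw [Dart.symm_symm]⟩
      ih

theorem Joined.of_subset (hD : ∀ d : G.Dart, d.edge ∈ D → M.Joined D' (M.face d) (M.face d.symm))
    (h : M.Joined D f g) : M.Joined D' f g := by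
  induction h with
  | refl => exact .refl
  | tail _ h ih =>
    obtain ⟨d, hd, rfl, rfl⟩ := h
    exact ih.trans (hD d hd)

theorem Joined.mono (hD : D ⊆ D') (h : M.Joined D f g) : M.Joined D' f g :=
  h.of_subset fun _ hd => joined_dart (hD hd)

/-- A walk that leaves a set of faces crosses an edge between this set and its complement. -/
theorem Joined.exists_leaving {S : Set M.Face} (h : M.Joined D f g) (hf : f ∈ S) (hg : g ∉ S) :
    ∃ d : G.Dart, d.edge ∈ D ∧ M.face d ∈ S ∧ M.face d.symm ∉ S := by
  induction h with
  | refl => exact absurd hf hg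
  | tail _ h ih =>
    obtain ⟨d, hd, rfl, rfl⟩ := h
    by_cases hS : M.face d ∈ S
    · exact ⟨d, hd, hS, hg⟩
    · exact ih hS

/-- Euler's formula: a set of edges whose dual edges connect all faces has at least
`|F| - 1 = |E| - |V| + 1` elements. -/
theorem card_edgeSet_lt_of_joined [Finite V] (hD : ∀ f g, M.Joined D f g) :
    Nat.card G.edgeSet + 1 ≤ Nat.card V + (G.edgeSet ∩ D).ncard := by
  let K : SimpleGraph M.Face := fromRel fun f g =>
    ∃ d : G.Dart, d.edge ∈ D ∧ M.face d = f ∧ M.face d.symm = g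
  have hreach : ∀ f g, K.Reachable f g := by
    intro f g
    induction hD f g with
    | refl => exact .refl _
    | @tail x y _ h ih =>
      by_cases hxy : x = y
      · exact hxy ▸ ih
      · exact ih.trans (Adj.reachable ((fromRel_adj _ _ _).2 ⟨hxy, Or.inl h⟩))
  have hE := M.euler
  by_cases hne : Nonempty M.Face
  swap
  · have h0 : Nat.card M.Face = 0 := by
      rw [not_nonempty_iff] at hne
      exact Nat.card_of_isEmpty
    change Nat.card V + Nat.card M.Face = _ at hE
    omega
  have hK : K.Connected := ⟨hreach⟩
  have hle := hK.card_vert_le_card_edgeSet_add_one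
  have hdart : ∀ k ∈ K.edgeSet, ∃ d : G.Dart, d.edge ∈ D ∧ s(M.face d, M.face d.symm) = k := by
    intro k hk
    induction k with
    | _ x y =>
      rcases ((fromRel_adj _ _ _).1 (show K.Adj x y from hk)).2 with
        ⟨d, hd, rfl, rfl⟩ | ⟨d, hd, rfl, rfl⟩
      · exact ⟨d, hd, rfl⟩
      · exact ⟨d, hd, Sym2.eq_swap⟩
  obtain ⟨f₀⟩ := hne
  obtain ⟨d₀, -⟩ := M.exists_face_eq f₀
  have : Nonempty G.Dart := ⟨d₀⟩
  choose! δ hδ using hdart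
  have hcard : K.edgeSet.ncard ≤ (G.edgeSet ∩ D).ncard := by
    refine Set.ncard_le_ncard_of_injOn (fun k => (δ k).edge)
      (fun k hk => ⟨(δ k).edge_mem, (hδ k hk).1⟩) ?_ (Set.toFinite _)
    intro k hk l hl h
    rw [← (hδ k hk).2, ← (hδ l hl).2]
    rcases (dart_edge_eq_iff _ _).1 h with h | h
    · rw [h]
    · rw [h, Dart.symm_symm, Sym2.eq_swap]
  rw [Nat.card_coe_set_eq K.edgeSet] at hle
  change Nat.card V + Nat.card M.Face = _ at hE
  omega

variable (M) in
/-- The separation properties of the edge set `H` of a Hamiltonian cycle in a cubic plane graph,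
where joining faces avoids `H`: the faces on the two sides of an edge of `H` are not joined,
together they are joined to all faces, and every chord is a bridge of the dual without `H`. -/
structure HamiltonianCut (H : Set (Sym2 V)) : Prop where
  exists_dart : ∀ v, ∃ d : G.Dart, d.edge ∈ H ∧ d.fst = v
  not_joined : ∀ d : G.Dart, d.edge ∈ H → ¬ M.Joined Hᶜ (M.face d) (M.face d.symm)
  joined_or_joined : ∀ d : G.Dart, d.edge ∈ H → ∀ f,
    M.Joined Hᶜ (M.face d) f ∨ M.Joined Hᶜ (M.face d.symm) f
  not_joined_chord : ∀ d : G.Dart, d.edge ∉ H →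
    ¬ M.Joined (Hᶜ \ {d.edge}) (M.face d) (M.face d.symm)

/-- The Jordan curve theorem in the form needed here, from Euler's formula: as soon as the edges
off `H` join every face to one of the two sides of an edge of `H`, there are too few of them for
the two sides to be joined as well, or for any of them to be superfluous. -/
theorem hamiltonianCut_of_card [Finite V] {H : Set (Sym2 V)} (hH : H ⊆ G.edgeSet)
    (hcard : H.ncard = Nat.card V) {d₀ : G.Dart}
    (hcover : ∀ f, M.Joined Hᶜ (M.face d₀) f ∨ M.Joined Hᶜ (M.face d₀.symm) f)
    (hside : ∀ d : G.Dart, d.edge ∈ H → ∃ d' : G.Dart, (d' = d ∨ d' = d.symm) ∧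
      M.Joined Hᶜ (M.face d₀) (M.face d') ∧ M.Joined Hᶜ (M.face d₀.symm) (M.face d'.symm))
    (hvert : ∀ v, ∃ d : G.Dart, d.edge ∈ H ∧ d.fst = v) : M.HamiltonianCut H := by
  have hcompl : (G.edgeSet ∩ Hᶜ).ncard + Nat.card V = Nat.card G.edgeSet := by
    rw [← hcard, ← Set.sdiff_eq, Set.ncard_sdiff_add_ncard_of_subset hH, Nat.card_coe_set_eq]
  -- with both sides of `d₀` joined, everything is joined
  have hall : ∀ D : Set (Sym2 V), (∀ f g, M.Joined Hᶜ f g → M.Joined D f g) →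
      M.Joined D (M.face d₀) (M.face d₀.symm) → ∀ f g, M.Joined D f g := by
    intro D hD h₀
    have : ∀ f, M.Joined D (M.face d₀) f := fun f =>
      (hcover f).elim (fun h => hD _ _ h) fun h => h₀.trans (hD _ _ h)
    exact fun f g => (this f).symm.trans (this g)
  have hnot : ¬ M.Joined Hᶜ (M.face d₀) (M.face d₀.symm) := by
    intro h
    have := card_edgeSet_lt_of_joined (hall _ (fun _ _ h => h) h)
    omega
  refine ⟨hvert, ?_, ?_, ?_⟩
  · intro d hd h
    obtain ⟨d', rfl | rfl, h₁, h₂⟩ := hside d hd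
    · exact hnot ((h₁.trans h).trans h₂.symm)
    · rw [Dart.symm_symm] at h₂
      exact hnot ((h₁.trans h.symm).trans h₂.symm)
  · intro d hd f
    obtain ⟨d', rfl | rfl, h₁, h₂⟩ := hside d hd
    · exact (hcover f).imp h₁.symm.trans h₂.symm.trans
    · rw [Dart.symm_symm] at h₂
      exact (hcover f).symm.imp h₂.symm.trans h₁.symm.trans
  · intro d hd h
    -- trade the chord for an edge of `H`: all faces are still joined, by `|E| - |V|` edges
    have hle : ∀ f g, M.Joined Hᶜ f g → M.Joined (insert d₀.edge (Hᶜ \ {d.edge})) f g := by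
      refine fun f g hfg => hfg.of_subset fun x hx => ?_
      have h' := h.mono (Set.subset_insert d₀.edge _)
      by_cases hxd : x.edge = d.edge
      · rcases (dart_edge_eq_iff _ _).1 hxd with rfl | rfl
        · exact h'
        · rw [Dart.symm_symm]; exact h'.symm
      · exact joined_dart (Or.inr ⟨hx, hxd⟩)
    have h₁ := card_edgeSet_lt_of_joined
      (hall _ hle (joined_dart (Set.mem_insert _ _)))
    have h₂ : (G.edgeSet ∩ insert d₀.edge (Hᶜ \ {d.edge})).ncard ≤ (G.edgeSet ∩ Hᶜ).ncard := by
      have h₃ : G.edgeSet ∩ insert d₀.edge (Hᶜ \ {d.edge}) ⊆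
          insert d₀.edge ((G.edgeSet ∩ Hᶜ) \ {d.edge}) := by
        rintro e ⟨he, rfl | ⟨he', hne⟩⟩
        · exact Or.inl rfl
        · exact Or.inr ⟨⟨he, he'⟩, hne⟩
      have h₄ := Set.ncard_sdiff_singleton_add_one
        (show d.edge ∈ G.edgeSet ∩ Hᶜ from ⟨d.edge_mem, hd⟩) (Set.toFinite _)
      have h₅ := Set.ncard_le_ncard h₃ (Set.toFinite _)
      have h₆ := Set.ncard_insert_le d₀.edge ((G.edgeSet ∩ Hᶜ) \ {d.edge})
      omega
    omega

section Cubic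

variable [G.LocallyFinite] (hcubic : G.IsRegularOfDegree 3)

include hcubic

/-- Two consecutive edges on a cycle of a cubic graph have on either side the same face or
two faces separated by the chord at their common vertex. -/
theorem joined_of_consecutive {H : Set (Sym2 V)}
    (hthree : ∀ d : G.Dart, d.edge ∈ H → (M.rot d).edge ∈ H → (M.rot (M.rot d)).edge ∈ H → False)
    {d d' : G.Dart} (hd : d.edge ∈ H) (hd' : d'.edge ∈ H) (h : d'.fst = d.snd)
    (hne : d' ≠ d.symm) : M.Joined Hᶜ (M.face d) (M.face d') := by
  rcases M.dart_eq_of_fst_eq hcubic (d := d.symm) h with rfl | rfl | rfl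
  · exact absurd rfl hne
  · rw [face_rot, Dart.symm_symm]
    exact .refl
  · have hx : (M.rot d.symm).edge ∈ Hᶜ := fun hx =>
      hthree d.symm (by rwa [Dart.edge_symm]) hx hd'
    have := joined_dart (M := M) hx
    rwa [face_rot, Dart.symm_symm, ← face_rot] at this

/-- Along a trail in `H`, all faces on the left are joined off `H`, and so are all faces on the
right. -/
theorem joined_of_isTrail {H : Set (Sym2 V)}
    (hthree : ∀ d : G.Dart, d.edge ∈ H → (M.rot d).edge ∈ H → (M.rot (M.rot d)).edge ∈ H → False)
    {v w : V} {q : G.Walk v w} (hq : q.IsTrail) (hqH : ∀ e ∈ q.edges, e ∈ H) {d₀ : G.Dart}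
    (h₀ : d₀.edge ∈ H) (hv : d₀.snd = v) (hd₀ : d₀.edge ∉ q.edges) :
    ∀ d ∈ q.darts, M.Joined Hᶜ (M.face d₀) (M.face d) ∧
      M.Joined Hᶜ (M.face d₀.symm) (M.face d.symm) := by
  induction q generalizing d₀ with
  | nil => simp
  | @cons u x y hadj q ih =>
    rw [Walk.isTrail_cons] at hq
    simp only [Walk.edges_cons, List.mem_cons, forall_eq_or_imp] at hqH
    rw [Walk.edges_cons, List.mem_cons, not_or] at hd₀
    set d₁ : G.Dart := ⟨(u, x), hadj⟩ with hd₁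
    have hne : d₀.edge ≠ d₁.edge := hd₀.1
    have key : M.Joined Hᶜ (M.face d₀) (M.face d₁) ∧
        M.Joined Hᶜ (M.face d₀.symm) (M.face d₁.symm) := by
      refine ⟨joined_of_consecutive hcubic hthree h₀ hqH.1 hv.symm ?_,
        (joined_of_consecutive hcubic hthree (d := d₁.symm) (d' := d₀.symm) ?_ ?_ hv ?_).symm⟩
      · rintro h
        exact hne (by rw [h, Dart.edge_symm])
      · rw [Dart.edge_symm]; exact hqH.1
      · rwa [Dart.edge_symm]
      · rw [Dart.symm_symm]
        rintro h
        exact hne (by rw [← h, Dart.edge_symm])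
    intro d hd
    rw [Walk.darts_cons, List.mem_cons] at hd
    rcases hd with rfl | hd
    · exact key
    · have := ih hq.1 hqH.2 (d₀ := d₁) hqH.1 rfl hq.2 d hd
      exact ⟨key.1.trans this.1, key.2.trans this.2⟩

variable (M) in
theorem hamiltonianCut_of_isHamiltonianCycle [Finite V] [DecidableEq V] {a : V} {p : G.Walk a a}
    (hp : p.IsHamiltonianCycle) : M.HamiltonianCut {e | e ∈ p.edges} := by
  have := Fintype.ofFinite V
  -- at every vertex, two of the three darts lie on the cycle
  have htwo : ∀ v, ∃ x y, x ≠ y ∧ G.Adj v x ∧ G.Adj v y ∧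
      ∀ w, s(v, w) ∈ p.edges ↔ w = x ∨ w = y := by
    intro v
    obtain ⟨x, y, hxy, h⟩ := Set.ncard_eq_two.1
      (hp.isCycle.ncard_neighborSet_toSubgraph_eq_two (hp.mem_support v))
    have h' : ∀ w, s(v, w) ∈ p.edges ↔ w = x ∨ w = y := by
      intro w
      rw [← Walk.adj_toSubgraph_iff_mem_edges, ← Subgraph.mem_neighborSet, h]
      simp
    exact ⟨x, y, hxy, p.adj_of_mem_edges ((h' x).2 (Or.inl rfl)),
      p.adj_of_mem_edges ((h' y).2 (Or.inr rfl)), h'⟩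
  have hthree : ∀ d : G.Dart, d.edge ∈ p.edges → (M.rot d).edge ∈ p.edges →
      (M.rot (M.rot d)).edge ∈ p.edges → False := by
    intro d h₁ h₂ h₃
    obtain ⟨x, y, -, -, -, h⟩ := htwo d.fst
    have f₁ : (M.rot d).fst = d.fst := M.rot_fst d
    have f₂ : (M.rot (M.rot d)).fst = d.fst := (M.rot_fst _).trans f₁
    have e₁ : s(d.fst, d.snd) ∈ p.edges := h₁
    have e₂ : s((M.rot d).fst, (M.rot d).snd) ∈ p.edges := h₂
    have e₃ : s((M.rot (M.rot d)).fst, (M.rot (M.rot d)).snd) ∈ p.edges := h₃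
    rw [f₁] at e₂
    rw [f₂] at e₃
    have b₁ := mt (dart_ext f₁) (M.rot_ne_self hcubic d)
    have b₂ := mt (dart_ext f₂) (M.rot_rot_ne_self hcubic d)
    have b₃ := mt (dart_ext (f₂.trans f₁.symm)) (M.rot_ne_self hcubic (M.rot d))
    grind
  have hchord : ∀ x y : G.Dart, x.fst = y.fst → x.edge ∉ p.edges → y.edge ∉ p.edges → x = y := by
    intro d d' hdd h₁ h₂
    obtain ⟨x, y, hxy, hx, hy, h⟩ := htwo d.fst
    obtain ⟨X, Y, Z, -, -, -, hN⟩ := exists_three_neighbors hcubic d.fst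
    refine dart_ext hdd ?_
    have e₁ : s(d.fst, d.snd) ∉ p.edges := h₁
    have e₂ : s(d'.fst, d'.snd) ∉ p.edges := h₂
    have a₁ := d.adj
    have a₂ := d'.adj
    rw [← hdd] at e₂ a₂
    rw [h] at e₁ e₂
    rw [hN] at a₁ a₂ hx hy
    grind
  have hmem : ∀ d : G.Dart, d.edge ∈ p.edges → ∃ d' ∈ p.darts, d' = d ∨ d' = d.symm := by
    intro d hd
    obtain ⟨d', hd', h⟩ := List.mem_map.1 hd
    exact ⟨d', hd', (dart_edge_eq_iff _ _).1 h⟩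
  obtain ⟨d₀, hjoin⟩ : ∃ d₀ : G.Dart, ∀ d ∈ p.darts,
      M.Joined {e | e ∈ p.edges}ᶜ (M.face d₀) (M.face d) ∧
      M.Joined {e | e ∈ p.edges}ᶜ (M.face d₀.symm) (M.face d.symm) := by
    have htrail := hp.isCycle.isTrail
    cases p with
    | nil => exact absurd hp.isCycle Walk.not_isCycle_nil
    | cons hadj q =>
      rw [Walk.isTrail_cons] at htrail
      refine ⟨⟨(_, _), hadj⟩, fun d hd => ?_⟩
      rw [Walk.darts_cons, List.mem_cons] at hd
      rcases hd with rfl | hd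
      · exact ⟨.refl, .refl⟩
      · exact joined_of_isTrail hcubic (H := {e | e ∈ (Walk.cons hadj q).edges}) hthree htrail.1
          (fun e he => List.mem_cons_of_mem _ he) List.mem_cons_self rfl htrail.2 d hd
  have hside : ∀ d : G.Dart, d.edge ∈ p.edges → ∃ d' : G.Dart, (d' = d ∨ d' = d.symm) ∧
      M.Joined {e | e ∈ p.edges}ᶜ (M.face d₀) (M.face d') ∧
      M.Joined {e | e ∈ p.edges}ᶜ (M.face d₀.symm) (M.face d'.symm) := by
    intro d hd
    obtain ⟨d', hd', h⟩ := hmem d hd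
    exact ⟨d', h, hjoin d' hd'⟩
  refine hamiltonianCut_of_card (fun e he => p.edges_subset_edgeSet he) ?_ (d₀ := d₀) ?_ hside ?_
  · have : {e | e ∈ p.edges} = (p.edges.toFinset : Set (Sym2 V)) := by ext; simp
    rw [this, Set.ncard_coe_finset, List.toFinset_card_of_nodup hp.isCycle.edges_nodup,
      Walk.length_edges, hp.length_eq, Nat.card_eq_fintype_card]
  · -- no two consecutive edges of a face are chords, so every face has an edge on the cycle
    intro f
    obtain ⟨d, hd, rfl⟩ : ∃ d : G.Dart, d.edge ∈ p.edges ∧ M.face d = f := by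
      obtain ⟨x, rfl⟩ := M.exists_face_eq f
      by_cases hx : x.edge ∈ p.edges
      · exact ⟨x, hx, rfl⟩
      · refine ⟨M.facePerm x, ?_, M.face_facePerm x⟩
        by_contra hy
        exact M.rot_ne_self hcubic x.symm
          (hchord _ _ (M.rot_fst _) hy (by rwa [Dart.edge_symm]))
    obtain ⟨d', rfl | rfl, h₁, h₂⟩ := hside d hd
    · exact Or.inl h₁
    · rw [Dart.symm_symm] at h₂
      exact Or.inr h₂
  · intro v
    obtain ⟨x, y, -, hx, -, h⟩ := htwo v
    exact ⟨⟨(v, x), hx⟩, (h x).2 (Or.inl rfl), rfl⟩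

end Cubic

end SimpleGraph.PlaneEmbedding

/-! ### Running the algorithm inside a Hamiltonian cycle -/

namespace SimpleGraph.PlaneEmbedding

variable {V : Type*} {G : SimpleGraph V} {M : G.PlaneEmbedding}
  {outer : M.Face} {es : List (Sym2 V)} {σ : G.Subgraph} {H : Set (Sym2 V)}

theorem HamiltonianCut.face_ne (hH : M.HamiltonianCut H) (d : G.Dart) :
    M.face d ≠ M.face d.symm := by
  intro h
  by_cases hd : d.edge ∈ H
  · exact hH.not_joined d hd (h ▸ .refl)
  · exact hH.not_joined_chord d hd (h ▸ .refl)

/-- The absorbed faces are joined to the outer face by the edges used. -/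
theorem joined_absorbed (hT : (M.dualUnion outer es).IsTree) {f : M.Face}
    (hf : f ∈ M.absorbed outer es) : M.Joined {e | e ∈ es} outer f := by
  refine Relation.ReflTransGen.mono ?_ _ _ (hT.1.2 _ outer_mem_absorbed _ hf)
  rintro x y ⟨e, he⟩
  obtain ⟨h, d, rfl, rfl, rfl⟩ := dualUnion_isLink.1 he
  exact ⟨d, h, rfl, rfl⟩

/-- A chord between two absorbed faces has been used, for it would close a cycle otherwise. -/
theorem HamiltonianCut.mem_of_absorbed (hH : M.HamiltonianCut H)
    (hT : (M.dualUnion outer es).IsTree) (hes : ∀ e ∈ es, e ∉ H) {d : G.Dart} (hd : d.edge ∉ H)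
    (h₁ : M.face d ∈ M.absorbed outer es) (h₂ : M.face d.symm ∈ M.absorbed outer es) :
    d.edge ∈ es := by
  by_contra hmem
  refine hH.not_joined_chord d hd
    (((joined_absorbed hT h₁).symm.trans (joined_absorbed hT h₂)).mono fun e he => ⟨hes e he, ?_⟩)
  rintro rfl
  exact hmem he

section Cubic

variable [G.LocallyFinite] (hcubic : G.IsRegularOfDegree 3)

include hcubic

/-- If no face lies on both sides of an edge, the three corners at a vertex lie in different
faces. -/
theorem face_injOn_darts (hne : ∀ d, M.face d ≠ M.face d.symm) (x y : G.Dart)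
    (h : M.face x = M.face y) (hf : x.fst = y.fst) : x = y := by
  rcases M.dart_eq_of_fst_eq hcubic hf.symm with rfl | rfl | rfl
  · rfl
  · rw [face_rot] at h
    exact absurd h (hne x)
  · have h' := M.face_rot (M.rot (M.rot x))
    rw [M.rot_rot_rot hcubic, h] at h'
    exact absurd h' (hne _)

/-- Every chord between an absorbed face and a new face allows a step: if an interior vertex
of the rest of the boundary of the new face were already on `σ`, then an edge at that vertex would
lie between the new face and an absorbed one, which are already joined without it. -/
theorem HamiltonianCut.exists_isComplementaryPath [Finite V] (hH : M.HamiltonianCut H)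
    (hr : M.Run outer es σ) (hes : ∀ e ∈ es, e ∉ H) {d : G.Dart} (hd : d.edge ∉ H)
    (h₁ : M.face d ∈ M.absorbed outer es) (h₂ : M.face d.symm ∉ M.absorbed outer es) :
    ∃ q : G.Walk d.fst d.snd, M.IsComplementaryPath σ q := by
  have hI := hr.frontier hcubic
  have hT := hr.isTree hcubic
  obtain ⟨q, hq, -, hb⟩ := M.exists_isPath_boundary
    (face_injOn_darts hcubic hH.face_ne) hH.face_ne d.symm
  refine ⟨q, hI.adj_of_sides d h₁ h₂, hq, ?_, M.face d.symm, hb⟩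
  intro w hw hwσ
  by_contra hends
  rw [not_or] at hends
  obtain ⟨x, hx, rfl⟩ : ∃ x : G.Dart, M.face x = M.face d.symm ∧ x.fst = w := by
    rw [← mem_verts_boundary, hb]
    exact Or.inl ((Walk.mem_verts_toSubgraph q).2 hw)
  obtain ⟨g, hg, hwg⟩ := (hI.mem_verts_iff _).1 hwσ
  obtain ⟨y, rfl, hy⟩ := M.mem_verts_boundary.1 hwg
  -- an edge `z` at `w` between the two faces
  obtain ⟨z, hz, hzx⟩ : ∃ z : G.Dart, z.fst = x.fst ∧
      (M.face z = M.face x ∧ M.face z.symm = M.face y ∨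
        M.face z = M.face y ∧ M.face z.symm = M.face x) := by
    rcases M.dart_eq_of_fst_eq hcubic hy with rfl | rfl | rfl
    · exact absurd (hx ▸ hg) h₂
    · exact ⟨x, rfl, Or.inl ⟨rfl, (M.face_rot x).symm⟩⟩
    · refine ⟨M.rot (M.rot x), hy, Or.inr ⟨rfl, ?_⟩⟩
      rw [← face_rot, M.rot_rot_rot hcubic]
  have hdz : d.edge ≠ z.edge := by
    intro h
    rcases (dart_edge_eq_iff _ _).1 h with rfl | rfl
    · exact hends.1 hz.symm
    · exact hends.2 hz.symm
  -- avoiding `z`, its sides are joined through `d` and the absorbed faces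
  have hjd : ∀ D : Set (Sym2 V), d.edge ∈ D → {e | e ∈ es} ⊆ D →
      M.Joined D (M.face x) (M.face y) := by
    intro D hD hD'
    rw [hx]
    exact (joined_dart hD).symm.trans
      (((joined_absorbed hT h₁).symm.trans (joined_absorbed hT hg)).mono hD')
  have hjz : ∀ D : Set (Sym2 V), d.edge ∈ D → {e | e ∈ es} ⊆ D →
      M.Joined D (M.face z) (M.face z.symm) := by
    intro D hD hD'
    rcases hzx with ⟨e₁, e₂⟩ | ⟨e₁, e₂⟩
    · rw [e₁, e₂]; exact hjd D hD hD'
    · rw [e₁, e₂]; exact (hjd D hD hD').symm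
  have hzes : z.edge ∉ es := by
    intro h
    refine h₂ (Or.inr ⟨_, h, ?_⟩)
    rw [← hx]
    rcases hzx with ⟨e₁, e₂⟩ | ⟨e₁, e₂⟩
    · exact e₁ ▸ ⟨_, dual_isLink_dart z⟩
    · exact e₂ ▸ ⟨_, (dual_isLink_dart z).symm⟩
  by_cases hzH : z.edge ∈ H
  · exact hH.not_joined z hzH (hjz _ hd hes)
  · refine hH.not_joined_chord z hzH (hjz _ ⟨hd, hdz⟩ fun e he => ⟨hes e he, ?_⟩)
    rintro rfl
    exact hzes he

/-- Every run avoiding `H` extends to one that absorbs all faces on the outer side of `H`. -/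
theorem HamiltonianCut.exists_run [Finite V] (hH : M.HamiltonianCut H)
    (hr : M.Run outer es σ) (hes : ∀ e ∈ es, e ∉ H) :
    ∃ es' σ', M.Run outer es' σ' ∧ (∀ e ∈ es', e ∉ H) ∧
      ∀ f, M.Joined Hᶜ outer f → f ∈ M.absorbed outer es' := by
  induction hn : (M.absorbed outer es)ᶜ.ncard using Nat.strong_induction_on
    generalizing es σ with
  | _ n ih =>
    by_cases hall : ∀ f, M.Joined Hᶜ outer f → f ∈ M.absorbed outer es
    · exact ⟨es, σ, hr, hes, hall⟩
    push Not at hall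
    obtain ⟨f, hf, hfs⟩ := hall
    obtain ⟨d, hd, h₁, h₂⟩ := hf.exists_leaving outer_mem_absorbed hfs
    obtain ⟨q, hq⟩ := hH.exists_isComplementaryPath hcubic hr hes hd h₁ h₂
    refine ih _ ?_ (hr.step hq) ?_ rfl
    · rw [← hn]
      refine Set.ncard_lt_ncard ?_ (Set.toFinite _)
      rw [compl_lt_compl_iff_lt]
      have := absorbed_append (d := d.symm) (es := es) (outer := outer)
        (by rwa [Dart.symm_symm])
      rw [Dart.edge_symm] at this
      change M.absorbed outer es ⊂ M.absorbed outer (es ++ [d.edge])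
      rw [this]
      exact Set.ssubset_insert h₂
    · intro e he
      rcases List.mem_append.1 he with he | he
      · exact hes e he
      · rw [List.mem_singleton.1 he]
        exact hd

/-- The run that absorbs the outer side of `H` is complete, and its tree has both properties. -/
theorem exists_produces_of_hamiltonianCut [Finite V] (hH : M.HamiltonianCut H)
    (outer : M.Face) : ∃ T : Graph M.Face (Sym2 V), M.Produces outer T ∧
      (∀ v : V, ∃ f ∈ T.vertexSet, v ∈ (M.boundary f).verts) ∧
      (∀ f ∈ T.vertexSet, ∀ g ∈ T.vertexSet, f ≠ g →
        ∀ e : Sym2 V, M.dual.IsLink e f g → e ∈ T.edgeSet) := by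
  have hstart : M.Run outer [] (M.boundary outer) := by
    refine .start ?_
    obtain ⟨d, rfl⟩ := M.exists_face_eq outer
    obtain ⟨q, hq, hd, hb⟩ := M.exists_isPath_boundary
      (face_injOn_darts hcubic hH.face_ne) hH.face_ne d
    refine ⟨_, .cons d.adj q, (Walk.cons_isCycle_iff _ _).2 ⟨hq, hd⟩, ?_⟩
    rw [hb, Walk.toSubgraph, sup_comm, subgraphOfAdj_symm]
  obtain ⟨es, σ, hr, hes, hall⟩ := hH.exists_run hcubic hstart (by simp)
  have hT := hr.isTree hcubic
  have hcover : ∀ v : V, ∃ f ∈ M.absorbed outer es, v ∈ (M.boundary f).verts := by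
    intro v
    obtain ⟨d, hd, rfl⟩ := hH.exists_dart v
    rcases hH.joined_or_joined d hd outer with h | h
    · exact ⟨_, hall _ h.symm, M.mem_boundary_fst d⟩
    · exact ⟨_, hall _ h.symm, d.symm, rfl, by simp [Dart.edge]⟩
  refine ⟨_, ⟨es, σ, hr, fun u v p hp => ?_, rfl⟩, hcover, ?_⟩
  · obtain ⟨w, -, hw⟩ := hp.exists_not_mem hcubic
    exact hw (((hr.frontier hcubic).mem_verts_iff w).2 (hcover w))
  · rintro f hf g hg - e ⟨d, rfl, rfl, rfl⟩
    rw [vertexSet_dualUnion] at hf hg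
    have hj : ∀ f ∈ M.absorbed outer es, M.Joined Hᶜ outer f :=
      fun f hf => (joined_absorbed hT hf).mono hes
    have hd : d.edge ∉ H := fun hd => hH.not_joined d hd ((hj _ hf).symm.trans (hj _ hg))
    exact (dualUnion_isLink.2 ⟨hH.mem_of_absorbed hT hes hd hf hg, dual_isLink_dart d⟩).edge_mem

/-- A run whose absorbed faces cover all vertices has reached a Hamiltonian cycle. -/
theorem Run.isHamiltonian [Fintype V] [DecidableEq V] (hr : M.Run outer es σ)
    (hcover : ∀ v : V, ∃ f ∈ M.absorbed outer es, v ∈ (M.boundary f).verts) :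
    G.IsHamiltonian := by
  intro _
  obtain ⟨a, c, hc, hcσ⟩ := hr.exists_isCycle hcubic
  refine ⟨a, c, hc, hc.isPath_tail.isHamiltonian_of_mem fun w => ?_⟩
  have hw : w ∈ c.support := by
    rw [← Walk.mem_verts_toSubgraph, hcσ]
    exact ((hr.frontier hcubic).mem_verts_iff w).2 (hcover w)
  rw [Walk.support_tail_of_not_nil _ hc.not_nil]
  rcases (Walk.mem_support_iff _).1 hw with rfl | h
  · exact Walk.end_mem_tail_support hc.not_nil
  · exact h

end Cubic

end SimpleGraph.PlaneEmbedding

theorem theorem1 {V : Type*} [Fintype V] [DecidableEq V] (G : SimpleGraph V) [DecidableRel G.Adj]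
    (hconn : G.Connected) (hcubic : G.IsRegularOfDegree 3)
    (M : G.PlaneEmbedding) (outer : M.Face) :
    (∀ T : Graph M.Face (Sym2 V), M.Produces outer T →
      T ≤ M.dual ∧ T.IsTree ∧ outer ∈ T.vertexSet) ∧
    (G.IsHamiltonian ↔
      ∃ T : Graph M.Face (Sym2 V), M.Produces outer T ∧
        (∀ v : V, ∃ f ∈ T.vertexSet, v ∈ (M.boundary f).verts) ∧
        (∀ f ∈ T.vertexSet, ∀ g ∈ T.vertexSet, f ≠ g →
          ∀ e : Sym2 V, M.dual.IsLink e f g → e ∈ T.edgeSet)) := by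
  refine ⟨?_, ?_, ?_⟩
  · rintro _ ⟨es, σ, hr, -, rfl⟩
    exact ⟨SimpleGraph.PlaneEmbedding.dualUnion_le_dual, hr.isTree hcubic,
      SimpleGraph.PlaneEmbedding.outer_mem_absorbed⟩
  · intro hham
    obtain ⟨v⟩ := hconn.nonempty
    obtain ⟨x, y, z, -, -, -, h⟩ := SimpleGraph.PlaneEmbedding.exists_three_neighbors hcubic v
    have : Nontrivial V := ⟨v, x, ((h x).2 (Or.inl rfl)).ne⟩
    obtain ⟨p, hp⟩ := hham.exists_isHamiltonianCycle v
    exact SimpleGraph.PlaneEmbedding.exists_produces_of_hamiltonianCut hcubic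
      (SimpleGraph.PlaneEmbedding.hamiltonianCut_of_isHamiltonianCycle M hcubic hp) outer
  · rintro ⟨_, ⟨es, σ, hr, -, rfl⟩, hcover, -⟩
    exact hr.isHamiltonian hcubic hcover
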